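/- **Theorem (weak topological Erdős–Milner theorem).** All ordinal arithmetic (sums, products, powers) is in the ordinal sense; an ordinal is identified with the set of smaller ordinals and carries the order topology, and $[X]^n$ denotes the set of $n$-element subsets of $X$. For ordinals $\delta,\gamma$ and a positive integer $m$, write \[\delta\to_{top}(\gamma,m)^2\] to mean that for every coloring $c:[\delta]^2\to\{\text{red},\text{blue}\}$ there is either a subspace $X\subseteq\delta$ that is homeomorphic to $\gamma$ and satisfies $c(s)=\text{red}$ for all $s\in[X]^2$, or a subset $X\subseteq\delta$ with exactly $m$ elements that satisfies $c(s)=\text{blue}$ for all $s\in[X]^2$. Let $\alpha$ and $\beta$ be countable nonzero ordinals, and let $k>1$ be an integer. If \[\omega^{\omega^\alpha}\to_{top}(\omega^\beta,k)^2,\] then \[\omega^{\omega^\alpha\cdot\beta}\to_{top}(\omega^\beta,k+1)^2.\] -/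

import Mathlib

/-- The topological partition relation `β →_top (a i)ⁿ_{i ∈ ι}` for ordinals.

An ordinal `γ` is represented by the space `Set.Iio γ` of the ordinals below it, whose subspace
topology is the order topology. The relation says that for every coloring `c : [β]ⁿ → ι` of the
`n`-element subsets of `β` there are a subspace `X ⊆ β` and a color `i` such that every `n`-element
subset of `X` has color `i` and `X` is homeomorphic to the ordinal `a i`. -/
def TopArrow.{u, v} {ι : Type v} (β : Ordinal.{u}) (a : ι → Ordinal.{u}) (n : ℕ) : Prop :=
  ∀ c : Set.powersetCard (Set.Iio β) n → ι,
    ∃ (X : Set (Set.Iio β)) (i : ι),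
      (∀ s : Set.powersetCard (Set.Iio β) n,
        ((s : Finset (Set.Iio β)) : Set (Set.Iio β)) ⊆ X → c s = i) ∧
      Nonempty (X ≃ₜ Set.Iio (a i))

/-!
Write `t = ω ^ (ω ^ α * β)` and regard the blue pairs as the edges of a graph on `t`. If the
neighbourhood of some point `x` contains a copy of `ω ^ ω ^ α`, the hypothesis applied inside that
copy yields a red copy of `ω ^ β` or a blue clique of size `k`, and in the latter case `x` is added
to the clique. It remains to find a red copy of `ω ^ β` when no neighbourhood contains a copy of
`ω ^ ω ^ α`.

Copies of powers of `ω` are detected by Cantor–Bendixson ranks: `IterLim A δ y` says that `y` has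
rank at least `δ` in `A ∪ {y}`, and if `y` and `δ` are countable and `δ ≠ 0`, then `A` contains a
copy of `ω ^ δ` (`IterLim.exists_isEmbedding`). The rank with respect to a union of two sets is at
most the Hessenberg sum of the two ranks (`not_iterLim_union`). Since `ω ^ α` is closed under
Hessenberg sums, the points adjacent to some member of a finite set still have all ranks below
`ω ^ α`, and removing them does not lower any rank of the form `ω ^ α * η`
(`IterLim.exists_notMem`).

A red set `X` is then built from finite approximations (`exists_isIndepSet_iterLim`). Each chosen
point `x` carries a label `η ≤ β` such that `x` has rank at least `ω ^ α * η` in the space of all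
ordinals. By the previous paragraph, for every `η' < η` there are points with label `η'` arbitrarily
close to `x` from below that are red to all earlier choices. A sufficiently generic choice,
starting from `t` itself with label `β`, makes every point with label `η` have rank at least `η`
with respect to `X`. So `t` has rank at least `β` with respect to `X`, and `X` contains a copy of
`ω ^ β`.
-/

universe u

/-! ### The Hessenberg sum -/

/-- The Hessenberg (natural) sum of two ordinals, defined as the least ordinal function that is
strictly increasing in each argument. -/
noncomputable def hsum (a b : Ordinal.{u}) : Ordinal.{u} :=
  max (⨆ x : Set.Iio a, Order.succ (hsum x.1 b)) (⨆ x : Set.Iio b, Order.succ (hsum a x.1))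
termination_by (a, b)
decreasing_by
  · exact Prod.Lex.left _ _ x.2
  · exact Prod.Lex.right _ x.2

theorem hsum_le_iff {a b c : Ordinal.{u}} :
    hsum a b ≤ c ↔ (∀ x < a, hsum x b < c) ∧ ∀ y < b, hsum a y < c := by
  rw [hsum, max_le_iff, Ordinal.iSup_le_iff, Ordinal.iSup_le_iff]
  simp

theorem hsum_lt_hsum_left {a a' : Ordinal.{u}} (h : a' < a) (b : Ordinal.{u}) :
    hsum a' b < hsum a b :=
  (hsum_le_iff.1 le_rfl).1 a' h

theorem hsum_lt_hsum_right (a : Ordinal.{u}) {b b' : Ordinal.{u}} (h : b' < b) :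
    hsum a b' < hsum a b :=
  (hsum_le_iff.1 le_rfl).2 b' h

/-- If `g` is closed under the Hessenberg sum, then division by `g` is compatible with the
Hessenberg sum, provided that the second quotient is finite. -/
theorem hsum_le_mul_div_add {g : Ordinal.{u}} (hg : 0 < g)
    (H : ∀ a < g, ∀ b < g, hsum a b < g) (a b : Ordinal.{u}) (hb : b / g < Ordinal.omega0) :
    hsum a b ≤ g * (a / g + b / g) + hsum (a % g) (b % g) := by
  have hlt : ∀ {p q x y : Ordinal.{u}}, p < q →
      g * p + hsum (x % g) (y % g) < g * q + hsum (a % g) (b % g) := by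
    intro p q x y hpq
    calc g * p + hsum (x % g) (y % g) < g * p + g := by
          gcongr
          exact H _ (Ordinal.mod_lt _ hg.ne') _ (Ordinal.mod_lt _ hg.ne')
      _ = g * (p + 1) := by rw [mul_add_one]
      _ ≤ g * q := by
          gcongr
          exact Order.add_one_le_of_lt hpq
      _ ≤ _ := le_self_add
  have hmod : ∀ {x y : Ordinal.{u}}, x < y → x / g = y / g → x % g < y % g := by
    intro x y hxy hq
    have h := hxy
    rw [← Ordinal.div_add_mod x g, ← Ordinal.div_add_mod y g, hq] at h
    exact lt_of_add_lt_add_left h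
  rw [hsum_le_iff]
  constructor
  · intro x hx
    refine (hsum_le_mul_div_add hg H x b hb).trans_lt ?_
    rcases (Ordinal.div_le_left hx.le g).lt_or_eq with hq | hq
    · apply hlt
      obtain ⟨n, hn⟩ := Ordinal.lt_omega0.1 hb
      rw [hn]
      exact lt_of_not_ge fun h => hq.not_ge ((Ordinal.add_le_add_iff_right n).1 h)
    · rw [hq]
      gcongr
      exact hsum_lt_hsum_left (hmod hx hq) _
  · intro y hy
    have hq' := Ordinal.div_le_left hy.le g
    refine (hsum_le_mul_div_add hg H a y (hq'.trans_lt hb)).trans_lt ?_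
    rcases hq'.lt_or_eq with hq | hq
    · exact hlt (by gcongr)
    · rw [hq]
      gcongr
      exact hsum_lt_hsum_right _ (hmod hy hq)
termination_by (a, b)
decreasing_by
  · exact Prod.Lex.left _ _ hx
  · exact Prod.Lex.right _ hy

theorem hsum_lt_mul_add_one {g : Ordinal.{u}} (hg : 0 < g)
    (H : ∀ a < g, ∀ b < g, hsum a b < g) (a b : Ordinal.{u}) (hb : b / g < Ordinal.omega0) :
    hsum a b < g * (a / g + b / g + 1) := by
  refine (hsum_le_mul_div_add hg H a b hb).trans_lt ?_
  rw [mul_add_one]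
  gcongr
  exact H _ (Ordinal.mod_lt _ hg.ne') _ (Ordinal.mod_lt _ hg.ne')

theorem hsum_lt_omega0_opow (e : Ordinal.{u}) :
    ∀ a < Ordinal.omega0 ^ e, ∀ b < Ordinal.omega0 ^ e, hsum a b < Ordinal.omega0 ^ e := by
  induction e using Ordinal.limitRecOn with
  | zero =>
    intro a ha b hb
    rw [Ordinal.opow_zero, Order.lt_one_iff] at *
    subst ha hb
    rw [← nonpos_iff_eq_zero, hsum_le_iff]
    simp
  | add_one e ih =>
    intro a ha b hb
    rw [Ordinal.opow_add_one] at *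
    have hpos : 0 < Ordinal.omega0 ^ e := Ordinal.opow_pos _ Ordinal.omega0_pos
    rw [Ordinal.lt_mul_iff_div_lt hpos.ne'] at ha hb
    refine (hsum_lt_mul_add_one hpos ih a b hb).trans_le ?_
    gcongr
    exact (Ordinal.isPrincipal_add_omega0 (Ordinal.isPrincipal_add_omega0 ha hb)
      Ordinal.one_lt_omega0).le
  | limit e he ih =>
    intro a ha b hb
    obtain ⟨c, hc, hac⟩ := (Ordinal.lt_opow_of_isSuccLimit Ordinal.omega0_ne_zero he).1 ha
    obtain ⟨d, hd, hbd⟩ := (Ordinal.lt_opow_of_isSuccLimit Ordinal.omega0_ne_zero he).1 hb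
    have hm := max_lt hc hd
    refine (ih _ hm a (hac.trans_le ?_) b (hbd.trans_le ?_)).trans_le ?_ <;>
      apply Ordinal.opow_le_opow_right Ordinal.omega0_pos
    exacts [le_max_left _ _, le_max_right _ _, hm.le]

theorem hsum_lt_omega0_opow_mul {e x a b : Ordinal.{u}} (ha : a < Ordinal.omega0 ^ e * x)
    (hb : b < Ordinal.omega0 ^ e) : hsum a b < Ordinal.omega0 ^ e * x := by
  have hpos : 0 < Ordinal.omega0 ^ e := Ordinal.opow_pos _ Ordinal.omega0_pos
  have hb0 : b / Ordinal.omega0 ^ e = 0 := Ordinal.div_eq_zero_of_lt hb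
  refine (hsum_lt_mul_add_one hpos (hsum_lt_omega0_opow e) a b
    (by rw [hb0]; exact Ordinal.omega0_pos)).trans_le ?_
  gcongr
  rw [hb0, add_zero]
  exact Order.add_one_le_of_lt ((Ordinal.lt_mul_iff_div_lt hpos.ne').1 ha)

/-! ### Iterated limit points of a set of ordinals -/

/-- `IterLim A δ y` says that `y` lies in the `δ`-th Cantor–Bendixson derivative of `A ∪ {y}`:
for every `δ' < δ` the ordinal `y` is a limit from below of points of `A` that are themselves
`δ'`-fold limits. The point `y` need not belong to `A`. -/
def IterLim (A : Set Ordinal.{u}) (δ y : Ordinal.{u}) : Prop :=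
  ∀ δ' < δ, 0 < y ∧ ∀ z < y, ∃ x ∈ A, z < x ∧ x < y ∧ IterLim A δ' x
termination_by δ

theorem iterLim_iff {A : Set Ordinal.{u}} {δ y : Ordinal.{u}} :
    IterLim A δ y ↔ ∀ δ' < δ, 0 < y ∧ ∀ z < y, ∃ x ∈ A, z < x ∧ x < y ∧ IterLim A δ' x := by
  rw [IterLim]

theorem IterLim.of_le {A : Set Ordinal.{u}} {δ δ' y : Ordinal.{u}} (h : IterLim A δ y)
    (hle : δ' ≤ δ) : IterLim A δ' y := by
  rw [iterLim_iff] at *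
  exact fun d hd => h d (hd.trans_le hle)

theorem IterLim.mono {A B : Set Ordinal.{u}} (hAB : A ⊆ B) {δ : Ordinal.{u}} :
    ∀ {y : Ordinal.{u}}, IterLim A δ y → IterLim B δ y := by
  induction δ using WellFoundedLT.induction with
  | ind δ ih =>
    intro y h
    rw [iterLim_iff] at *
    intro d hd
    refine ⟨(h d hd).1, fun z hz => ?_⟩
    obtain ⟨x, hxA, hzx, hxy, hx⟩ := (h d hd).2 z hz
    exact ⟨x, hAB hxA, hzx, hxy, ih d hd hx⟩

theorem exists_not_iterLim_add_one {A : Set Ordinal.{u}} {δ y : Ordinal.{u}}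
    (h : ¬ IterLim A δ y) : ∃ δ' < δ, ¬ IterLim A (δ' + 1) y := by
  rw [iterLim_iff] at h
  push Not at h
  obtain ⟨d, hd, h⟩ := h
  refine ⟨d, hd, fun hc => ?_⟩
  rw [iterLim_iff] at hc
  obtain ⟨h0, hc⟩ := hc d (lt_add_one d)
  obtain ⟨z, hz, h⟩ := h h0
  obtain ⟨x, hxA, hzx, hxy, hx⟩ := hc z hz
  exact h x hxA hzx hxy hx

theorem exists_not_iterLim_Ioo {A : Set Ordinal.{u}} {δ y : Ordinal.{u}} (hy : 0 < y)
    (h : ¬ IterLim A (δ + 1) y) :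
    ∃ z < y, ∀ x ∈ A, z < x → x < y → ¬ IterLim A δ x := by
  rw [iterLim_iff] at h
  push Not at h
  obtain ⟨d, hd, h⟩ := h
  obtain ⟨z, hz, h⟩ := h hy
  exact ⟨z, hz, fun x hxA hzx hxy hx => h x hxA hzx hxy (hx.of_le (Order.lt_add_one_iff.1 hd))⟩

/-- Near a point of rank at most `δ` there are only points of rank at most `δ`. -/
theorem not_iterLim_add_one_of_mem_Ioo {A : Set Ordinal.{u}} {δ z x y : Ordinal.{u}}
    (h : ∀ x ∈ A, z < x → x < y → ¬ IterLim A δ x) (hzx : z < x) (hxy : x < y) :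
    ¬ IterLim A (δ + 1) x := by
  intro hx
  rw [iterLim_iff] at hx
  obtain ⟨w, hwA, hzw, hwx, hw⟩ := (hx δ (lt_add_one δ)).2 z hzx
  exact h w hwA hzw (hwx.trans hxy) hw

/-- The Cantor–Bendixson rank of a point with respect to a union is at most the Hessenberg sum
of its ranks with respect to the two parts. -/
theorem not_iterLim_union {B C : Set Ordinal.{u}} (b c : Ordinal.{u}) {y : Ordinal.{u}}
    (hb : ¬ IterLim B (b + 1) y) (hc : ¬ IterLim C (c + 1) y) :
    ¬ IterLim (B ∪ C) (hsum b c + 1) y := by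
  intro h
  rw [iterLim_iff] at h
  obtain ⟨hy, h⟩ := h _ (lt_add_one _)
  obtain ⟨z₁, hz₁, hB⟩ := exists_not_iterLim_Ioo hy hb
  obtain ⟨z₂, hz₂, hC⟩ := exists_not_iterLim_Ioo hy hc
  obtain ⟨x, hxBC, hzx, hxy, hx⟩ := h (max z₁ z₂) (max_lt hz₁ hz₂)
  obtain ⟨h₁, h₂⟩ := max_lt_iff.1 hzx
  rcases hxBC with hxB | hxC
  · obtain ⟨b', hb', hxb⟩ := exists_not_iterLim_add_one (hB x hxB h₁ hxy)
    refine not_iterLim_union b' c hxb (not_iterLim_add_one_of_mem_Ioo hC h₂ hxy) (hx.of_le ?_)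
    exact Order.add_one_le_of_lt (hsum_lt_hsum_left hb' c)
  · obtain ⟨c', hc', hxc⟩ := exists_not_iterLim_add_one (hC x hxC h₂ hxy)
    refine not_iterLim_union b c' (not_iterLim_add_one_of_mem_Ioo hB h₁ hxy) hxc (hx.of_le ?_)
    exact Order.add_one_le_of_lt (hsum_lt_hsum_right b hc')
termination_by (b, c)
decreasing_by
  · exact Prod.Lex.left _ _ hb'
  · exact Prod.Lex.right _ hc'

theorem not_iterLim_omega0_opow_mul_union {B C : Set Ordinal.{u}} {e x y : Ordinal.{u}}
    (hB : ¬ IterLim B (Ordinal.omega0 ^ e * x) y) (hC : ¬ IterLim C (Ordinal.omega0 ^ e) y) :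
    ¬ IterLim (B ∪ C) (Ordinal.omega0 ^ e * x) y := by
  obtain ⟨b, hb, hyb⟩ := exists_not_iterLim_add_one hB
  obtain ⟨c, hc, hyc⟩ := exists_not_iterLim_add_one hC
  exact fun h => not_iterLim_union b c hyb hyc
    (h.of_le (Order.add_one_le_of_lt (hsum_lt_omega0_opow_mul hb hc)))

theorem iterLim_univ_add_omega0_opow (δ : Ordinal.{u}) :
    ∀ a : Ordinal.{u}, IterLim Set.univ δ (a + Ordinal.omega0 ^ δ) := by
  induction δ using WellFoundedLT.induction with
  | ind δ ih =>
    intro a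
    rw [iterLim_iff]
    intro d hd
    have hpos : ∀ e : Ordinal.{u}, 0 < Ordinal.omega0 ^ e :=
      fun e => Ordinal.opow_pos _ Ordinal.omega0_pos
    refine ⟨(hpos δ).trans_le le_add_self, fun z hz => ?_⟩
    refine ⟨max z a + Ordinal.omega0 ^ d, trivial, ?_, ?_, ih d hd _⟩
    · exact (le_max_left z a).trans_lt (lt_add_of_pos_right _ (hpos d))
    · have hm : a ≤ max z a := le_max_right z a
      have hlt : max z a < a + Ordinal.omega0 ^ δ :=
        max_lt hz (lt_add_of_pos_right _ (hpos δ))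
      obtain ⟨w, hw⟩ := exists_add_of_le hm
      rw [hw] at hlt ⊢
      rw [add_assoc]
      gcongr
      exact Ordinal.isPrincipal_add_omega0_opow δ (lt_of_add_lt_add_left hlt)
        ((Ordinal.opow_lt_opow_iff_right Ordinal.one_lt_omega0).2 hd)

/-! ### Copies of powers of `ω` below an iterated limit point -/

/-- A countable power `ω ^ δ` with `δ ≠ 0` is the limit of a series `∑ ω ^ e n` with `e n < δ`. -/
theorem exists_seq_omega0_opow {δ : Ordinal.{u}} (hδ : (Set.Iio δ).Countable) (hδ0 : δ ≠ 0) :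
    ∃ e s : ℕ → Ordinal.{u}, (∀ n, e n < δ) ∧ s 0 = 0 ∧
      (∀ n, s (n + 1) = s n + Ordinal.omega0 ^ e n) ∧ (∀ n, s n < Ordinal.omega0 ^ δ) ∧
      ∀ x < Ordinal.omega0 ^ δ, ∃ n, x < s n := by
  have : Countable (Set.Iio δ) := hδ
  have : Nonempty (Set.Iio δ) := ⟨⟨0, pos_iff_ne_zero.2 hδ0⟩⟩
  obtain ⟨g, hg⟩ := exists_surjective_nat (Set.Iio δ)
  -- Every exponent below `δ` occurs infinitely often among the `e n`.
  let e : ℕ → Ordinal.{u} := fun n => (g n.unpair.1).1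
  let s : ℕ → Ordinal.{u} := fun n => Nat.rec 0 (fun n x => x + Ordinal.omega0 ^ e n) n
  have hs : ∀ n, s (n + 1) = s n + Ordinal.omega0 ^ e n := fun n => rfl
  have he : ∀ n, e n < δ := fun n => (g n.unpair.1).2
  have hmono : Monotone s := monotone_nat_of_le_succ fun n => by rw [hs]; exact le_self_add
  refine ⟨e, s, he, rfl, hs, fun n => ?_, fun x hx => ?_⟩
  · induction n with
    | zero => exact Ordinal.opow_pos _ Ordinal.omega0_pos
    | succ n ih =>
      rw [hs]
      exact Ordinal.isPrincipal_add_omega0_opow δ ih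
        ((Ordinal.opow_lt_opow_iff_right Ordinal.one_lt_omega0).2 (he n))
  · obtain ⟨d, hd, m, hm⟩ := (Ordinal.lt_omega0_opow hδ0).1 hx
    obtain ⟨k, hk⟩ := hg ⟨d, hd⟩
    have key : ∀ m : ℕ, ∃ n, Ordinal.omega0 ^ d * m ≤ s n := by
      intro m
      induction m with
      | zero => exact ⟨0, by simp⟩
      | succ m ih =>
        obtain ⟨n, hn⟩ := ih
        refine ⟨Nat.pair k n + 1, ?_⟩
        have hek : e (Nat.pair k n) = d := by simp [e, hk]
        rw [hs, hek, Nat.cast_succ, mul_add_one]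
        gcongr
        exact hn.trans (hmono (Nat.right_le_pair k n))
    obtain ⟨n, hn⟩ := key m
    exact ⟨n, hm.trans_le hn⟩

/-- If `t` is a `δ`-fold limit of points of `X`, then the interval `(a, a + ω ^ δ]` embeds
increasingly and continuously into `X ∪ {t}`, with `t` as the image of the right end point.
Continuity is expressed as continuity from the left at limit ordinals. -/
theorem IterLim.exists_strictMonoOn {X : Set Ordinal.{u}} (δ : Ordinal.{u}) :
    (Set.Iio δ).Countable → ∀ t : Ordinal.{u}, (Set.Iio t).Countable → IterLim X δ t →
    ∀ z < t, ∀ a : Ordinal.{u}, ∃ f : Ordinal.{u} → Ordinal.{u},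
      StrictMonoOn f (Set.Ioc a (a + Ordinal.omega0 ^ δ)) ∧
      f (a + Ordinal.omega0 ^ δ) = t ∧
      (∀ x ∈ Set.Ioo a (a + Ordinal.omega0 ^ δ), f x ∈ X) ∧
      (∀ x ∈ Set.Ioc a (a + Ordinal.omega0 ^ δ), z < f x) ∧
      ∀ y ∈ Set.Ioc a (a + Ordinal.omega0 ^ δ), Order.IsSuccLimit y →
        ∀ w < f y, ∃ x ∈ Set.Ioo a y, w < f x := by
  induction δ using WellFoundedLT.induction with
  | ind δ ih =>
  intro hδ t ht hX z hz a
  by_cases hδ0 : δ = 0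
  · subst hδ0
    have key : ∀ x ∈ Set.Ioc a (a + Ordinal.omega0 ^ (0 : Ordinal.{u})), x = a + 1 := by
      intro x hx
      rw [Ordinal.opow_zero] at hx
      exact le_antisymm hx.2 (Order.add_one_le_of_lt hx.1)
    refine ⟨fun _ => t, ?_, rfl, ?_, fun _ _ => hz, ?_⟩
    · intro x hx y hy hxy
      rw [key x hx, key y hy] at hxy
      exact absurd hxy (lt_irrefl _)
    · intro x hx
      have h := key x ⟨hx.1, hx.2.le⟩
      rw [Ordinal.opow_zero, h] at hx
      exact absurd hx.2 (lt_irrefl _)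
    · intro y hy hlim
      rw [key y hy] at hlim
      exact absurd hlim (Order.not_isSuccLimit_add_one a)
  obtain ⟨e, s, he, hs0, hs, hslt, hscof⟩ := exists_seq_omega0_opow hδ hδ0
  have ht0 : 0 < t := (zero_le (a := z)).trans_lt hz
  have : Countable (Set.Iio t) := ht
  have : Nonempty (Set.Iio t) := ⟨⟨0, ht0⟩⟩
  obtain ⟨g, hg⟩ := exists_surjective_nat (Set.Iio t)
  rw [iterLim_iff] at hX
  -- A sequence in `X` increasing to `t`, whose `n`-th term is an `e n`-fold limit.
  have hstep : ∀ (n : ℕ) (p : Set.Iio t), ∃ q : Set.Iio t,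
      q.1 ∈ X ∧ p < q ∧ g n < q ∧ IterLim X (e n) q.1 := by
    intro n p
    obtain ⟨x, hxX, hlt, hxt, hx⟩ :=
      (hX (e n) (he n)).2 (max p.1 (g n).1) (max_lt p.2 (g n).2)
    exact ⟨⟨x, hxt⟩, hxX, (le_max_left _ _).trans_lt hlt, (le_max_right _ _).trans_lt hlt, hx⟩
  choose nxt hnX hnlt hng hnlim using hstep
  let τ : ℕ → Set.Iio t := fun n => Nat.rec ⟨z, hz⟩ (fun n p => nxt n p) n
  have hτ : ∀ n, τ (n + 1) = nxt n (τ n) := fun n => rfl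
  have hτmono : StrictMono τ := strictMono_nat_of_lt_succ fun n => by rw [hτ]; exact hnlt n _
  have hf : ∀ n, ∃ f : Ordinal.{u} → Ordinal.{u},
      StrictMonoOn f (Set.Ioc (a + s n) (a + s (n + 1))) ∧
      f (a + s (n + 1)) = (τ (n + 1)).1 ∧
      (∀ x ∈ Set.Ioo (a + s n) (a + s (n + 1)), f x ∈ X) ∧
      (∀ x ∈ Set.Ioc (a + s n) (a + s (n + 1)), (τ n).1 < f x) ∧
      ∀ y ∈ Set.Ioc (a + s n) (a + s (n + 1)), Order.IsSuccLimit y →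
        ∀ w < f y, ∃ x ∈ Set.Ioo (a + s n) y, w < f x := by
    intro n
    rw [hs, ← add_assoc]
    exact ih (e n) (he n) (hδ.mono (Set.Iio_subset_Iio (he n).le)) (τ (n + 1)).1
      (ht.mono (Set.Iio_subset_Iio (τ (n + 1)).2.le)) (hnlim n (τ n)) (τ n).1
      (hτmono n.lt_succ_self) (a + s n)
  choose f hfmono hftop hfX hfz hflim using hf
  have hsmono : StrictMono s := strictMono_nat_of_lt_succ fun n => by
    rw [hs]; exact lt_add_of_pos_right _ (Ordinal.opow_pos _ Ordinal.omega0_pos)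
  set top := a + Ordinal.omega0 ^ δ with htop
  have hslt' : ∀ n, a + s n < top := fun n => (add_lt_add_iff_left a).2 (hslt n)
  have hapos : ∀ n, a < a + s (n + 1) := fun n => by
    refine lt_add_of_pos_right _ ?_
    rw [← hs0]
    exact hsmono n.succ_pos
  -- `N x` is the index of the interval of the partition that contains `x`.
  let N : Ordinal.{u} → ℕ := fun x => sInf {n | x ≤ a + s (n + 1)}
  have hNmem : ∀ x ∈ Set.Ioo a top, x ∈ Set.Ioc (a + s (N x)) (a + s (N x + 1)) := by
    intro x hx
    obtain ⟨w, hw⟩ := exists_add_of_le hx.1.le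
    have hne : {n | x ≤ a + s (n + 1)}.Nonempty := by
      obtain ⟨n, hn⟩ := hscof w (by
        have h := hx.2
        rw [hw, htop] at h
        exact lt_of_add_lt_add_left h)
      refine ⟨n, ?_⟩
      rw [Set.mem_ofPred_eq, hw]
      gcongr
      exact hn.le.trans (hsmono n.lt_succ_self).le
    refine ⟨?_, Nat.sInf_mem hne⟩
    rcases Nat.eq_zero_or_pos (N x) with h0 | h0
    · rw [h0, hs0, add_zero]
      exact hx.1
    · obtain ⟨m, hm⟩ := Nat.exists_eq_add_one.2 h0
      rw [hm]
      exact lt_of_not_ge (Nat.notMem_of_lt_sInf (m.lt_succ_self.trans_eq hm.symm))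
  have hNeq : ∀ n, ∀ x ∈ Set.Ioc (a + s n) (a + s (n + 1)), N x = n := by
    intro n x hx
    refine le_antisymm (Nat.sInf_le hx.2) (le_of_not_gt fun hlt => ?_)
    have hx' := hNmem x ⟨le_self_add.trans_lt hx.1, hx.2.trans_lt (hslt' _)⟩
    have : a + s (N x + 1) ≤ a + s n := by
      gcongr
      exact hsmono.monotone hlt
    exact absurd (hx'.2.trans this) hx.1.not_ge
  let F : Ordinal.{u} → Ordinal.{u} := fun x => if x < top then f (N x) x else t
  have hFlt : ∀ {x}, x < top → F x = f (N x) x := fun h => if_pos h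
  have hFtop : F top = t := if_neg (lt_irrefl _)
  have hFle : ∀ x ∈ Set.Ioo a top, F x ≤ (τ (N x + 1)).1 := by
    intro x hx
    have hm := hNmem x hx
    rw [hFlt hx.2, ← hftop]
    exact (hfmono (N x)).monotoneOn hm ⟨hm.1.trans_le hm.2, le_rfl⟩ hm.2
  have hFgt : ∀ x ∈ Set.Ioo a top, (τ (N x)).1 < F x := by
    intro x hx
    rw [hFlt hx.2]
    exact hfz _ x (hNmem x hx)
  refine ⟨F, ?_, hFtop, ?_, ?_, ?_⟩
  · intro x hx y hy hxy
    have hx' : x ∈ Set.Ioo a top := ⟨hx.1, hxy.trans_le hy.2⟩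
    rcases hy.2.lt_or_eq with hyt | rfl
    · have hy' : y ∈ Set.Ioo a top := ⟨hy.1, hyt⟩
      have hle : N x ≤ N y := Nat.sInf_le (hxy.le.trans (hNmem y hy').2)
      rcases hle.lt_or_eq with hlt | heq
      · exact (hFle x hx').trans_lt
          (lt_of_le_of_lt (hτmono.monotone (Nat.succ_le_of_lt hlt)) (hFgt y hy'))
      · rw [hFlt hx'.2, hFlt hyt]
        have h := hNmem x hx'
        rw [heq] at h ⊢
        exact hfmono _ h (hNmem y hy') hxy
    · rw [hFtop]
      exact (hFle x hx').trans_lt (τ (N x + 1)).2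
  · intro x hx
    have hm := hNmem x hx
    rw [hFlt hx.2]
    rcases hm.2.lt_or_eq with hlt | heq
    · exact hfX _ x ⟨hm.1, hlt⟩
    · have h := hftop (N x)
      rw [← heq] at h
      rw [h, hτ]
      exact hnX _ _
  · intro x hx
    rcases hx.2.lt_or_eq with hxt | rfl
    · exact lt_of_le_of_lt (hτmono.monotone (Nat.zero_le (N x))) (hFgt x ⟨hx.1, hxt⟩)
    · rw [hFtop]
      exact hz
  · intro y hy hlim w hw
    rcases hy.2.lt_or_eq with hyt | rfl
    · have hm := hNmem y ⟨hy.1, hyt⟩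
      rw [hFlt hyt] at hw
      obtain ⟨x, hx, hwx⟩ := hflim _ y hm hlim w hw
      refine ⟨x, ⟨le_self_add.trans_lt hx.1, hx.2⟩, ?_⟩
      rw [hFlt (hx.2.trans hyt), hNeq _ x ⟨hx.1, hx.2.le.trans hm.2⟩]
      exact hwx
    · rw [hFtop] at hw
      obtain ⟨n, hn⟩ := hg ⟨w, hw⟩
      refine ⟨a + s (n + 1), ⟨hapos n, hslt' _⟩, ?_⟩
      have hm : a + s (n + 1) ∈ Set.Ioc (a + s n) (a + s (n + 1)) :=
        ⟨(add_lt_add_iff_left a).2 (hsmono n.lt_succ_self), le_rfl⟩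
      rw [hFlt (hslt' _), hNeq n _ hm, hftop, hτ]
      have h := hng n (τ n)
      rw [hn] at h
      exact h

theorem isEmbedding_of_strictMono_of_isSuccLimit {κ : Ordinal.{u}}
    {g : Set.Iio κ → Ordinal.{u}} (hg : StrictMono g)
    (hlim : ∀ y : Set.Iio κ, Order.IsSuccLimit y.1 → ∀ w < g y, ∃ x < y, w < g x) :
    Topology.IsEmbedding g := by
  have hcont : Continuous g := by
    rw [continuous_iff_continuousAt]
    intro y
    refine tendsto_order.2 ⟨fun w hw => ?_, fun w hw => ?_⟩
    · by_cases hy : Order.IsSuccLimit y.1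
      · obtain ⟨x, hxy, hwx⟩ := hlim y hy w hw
        filter_upwards [lt_mem_nhds hxy] with v hv using hwx.trans (hg hv)
      · have hopen : IsOpen {v : Set.Iio κ | v.1 ∈ ({y.1} : Set Ordinal.{u})} :=
          (SuccOrder.isOpen_singleton_iff.2 hy).preimage continuous_subtype_val
        filter_upwards [hopen.mem_nhds rfl] with v hv
        rwa [Subtype.ext hv]
    · have hopen : IsOpen {v : Set.Iio κ | v.1 ∈ Set.Iio (Order.succ y.1)} :=
        isOpen_Iio.preimage continuous_subtype_val
      filter_upwards [hopen.mem_nhds (Order.lt_succ y.1)] with v hv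
      exact (hg.monotone (Order.lt_succ_iff.1 hv : v.1 ≤ y.1)).trans_lt hw
  refine ⟨⟨le_antisymm hcont.le_induced ?_⟩, hg.injective⟩
  rw [OrderTopology.topology_eq_generate_intervals (α := Set.Iio κ)]
  exact induced_topology_le_preorder hg.lt_iff_lt

/-- Below a countable `δ`-fold limit point of `X` there is a copy of `ω ^ δ` contained in `X`. -/
theorem IterLim.exists_isEmbedding {X : Set Ordinal.{u}} {δ t : Ordinal.{u}} (hδ0 : δ ≠ 0)
    (hδ : (Set.Iio δ).Countable) (ht : (Set.Iio t).Countable) (h : IterLim X δ t) :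
    ∃ g : Set.Iio (Ordinal.omega0 ^ δ) → Ordinal.{u},
      Topology.IsEmbedding g ∧ ∀ x, g x ∈ X ∧ g x < t := by
  have ht0 : 0 < t := ((iterLim_iff.1 h) 0 (pos_iff_ne_zero.2 hδ0)).1
  obtain ⟨f, hmono, htop, hX, -, hlim⟩ := h.exists_strictMonoOn δ hδ t ht 0 ht0 0
  rw [zero_add] at hmono htop hX hlim
  have h1 : (1 : Ordinal.{u}) < Ordinal.omega0 ^ δ :=
    Ordinal.one_lt_omega0.trans_le (Ordinal.left_le_opow _ (pos_iff_ne_zero.2 hδ0))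
  -- The interval `(0, ω ^ δ)` is reindexed by `ω ^ δ` through `x ↦ 1 + x`, which is continuous.
  have hmem : ∀ x : Set.Iio (Ordinal.omega0 ^ δ), 1 + x.1 ∈ Set.Ioo 0 (Ordinal.omega0 ^ δ) :=
    fun x => ⟨zero_lt_one.trans_le le_self_add,
      Ordinal.isPrincipal_add_omega0_opow δ h1 x.2⟩
  refine ⟨fun x => f (1 + x.1), isEmbedding_of_strictMono_of_isSuccLimit ?_ ?_, fun x =>
    ⟨hX _ (hmem x), ?_⟩⟩
  · intro x y hxy
    exact hmono (Set.Ioo_subset_Ioc_self (hmem x)) (Set.Ioo_subset_Ioc_self (hmem y))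
      ((add_lt_add_iff_left 1).2 hxy)
  · intro y hy w hw
    obtain ⟨x, hx, hwx⟩ := hlim _ (Set.Ioo_subset_Ioc_self (hmem y))
      (Ordinal.isSuccLimit_add 1 hy) w hw
    obtain ⟨v, rfl⟩ := exists_add_of_le (Order.one_le_iff_pos.2 hx.1)
    have hvy : v < y.1 := lt_of_add_lt_add_left hx.2
    exact ⟨⟨v, hvy.trans y.2⟩, hvy, hwx⟩
  · rw [← htop]
    exact hmono (Set.Ioo_subset_Ioc_self (hmem x))
      ⟨(hmem x).1.trans (hmem x).2, le_rfl⟩ (hmem x).2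

/-! ### A generic independent set of prescribed rank -/

theorem IterLim.le_of_subset_Iio {A : Set Ordinal.{u}} {t δ y : Ordinal.{u}}
    (hA : A ⊆ Set.Iio t) (hδ : 0 < δ) (h : IterLim A δ y) : y ≤ t := by
  refine le_of_not_gt fun hty => ?_
  obtain ⟨x, hxA, htx, -⟩ := ((iterLim_iff.1 h) 0 hδ).2 t hty
  exact lt_asymm htx (hA hxA)

theorem not_iterLim_finset_union {ι : Type*} (A : ι → Set Ordinal.{u}) {e y : Ordinal.{u}}
    (hA : ∀ i, ¬ IterLim (A i) (Ordinal.omega0 ^ e) y) (p : Finset ι) :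
    ¬ IterLim (⋃ i ∈ p, A i) (Ordinal.omega0 ^ e) y := by
  classical
  induction p using Finset.induction_on with
  | empty =>
    intro h
    obtain ⟨hy, h⟩ := (iterLim_iff.1 h) 0 (Ordinal.opow_pos _ Ordinal.omega0_pos)
    obtain ⟨x, hx, -⟩ := h 0 hy
    simp at hx
  | insert i p _ ih =>
    rw [Finset.set_biUnion_insert]
    have h := not_iterLim_omega0_opow_mul_union (B := ⋃ i ∈ p, A i) (x := 1)
      (by rwa [mul_one]) (hA i)
    rwa [mul_one, Set.union_comm] at h

/-- Points of rank `ω ^ e * η'` accumulate at points of larger rank even after the removal of a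
set all of whose ranks are below `ω ^ e`. -/
theorem IterLim.exists_notMem {C : Set Ordinal.{u}} {e η η' x z : Ordinal.{u}}
    (hC : ¬ IterLim C (Ordinal.omega0 ^ e) x)
    (hx : IterLim Set.univ (Ordinal.omega0 ^ e * η) x) (hη : η' < η) (hz : z < x) :
    ∃ v ∉ C, z < v ∧ v < x ∧ IterLim Set.univ (Ordinal.omega0 ^ e * η') v := by
  have hR : IterLim Cᶜ (Ordinal.omega0 ^ e * η) x := by
    by_contra hR
    have h := not_iterLim_omega0_opow_mul_union hR hC
    rw [Set.compl_union_self] at h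
    exact h hx
  have hlt : Ordinal.omega0 ^ e * η' < Ordinal.omega0 ^ e * η :=
    mul_lt_mul_of_pos_left hη (Ordinal.opow_pos _ Ordinal.omega0_pos)
  obtain ⟨v, hv, hzv, hvx, h⟩ := ((iterLim_iff.1 hR) _ hlt).2 z hz
  exact ⟨v, hv, hzv, hvx, h.mono (Set.subset_univ _)⟩

/-- A finite approximation to the independent set under construction: a finite set of pairs
`(x, η)`, where `x ≤ t` is a point of rank at least `ω ^ e * η` and `η ≤ β` is the rank that `x`
is meant to have with respect to the final set. The points are pairwise non-adjacent. -/
def IsApprox (G : SimpleGraph Ordinal.{u}) (e β t : Ordinal.{u})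
    (p : Finset (Ordinal.{u} × Ordinal.{u})) : Prop :=
  (∀ u ∈ p, u.1 ≤ t ∧ u.2 ≤ β ∧ IterLim Set.univ (Ordinal.omega0 ^ e * u.2) u.1) ∧
    ∀ u ∈ p, ∀ v ∈ p, ¬ G.Adj u.1 v.1

theorem IsApprox.exists_extension {G : SimpleGraph Ordinal.{u}} {e β t : Ordinal.{u}}
    (hG : ∀ x y, ¬ IterLim (G.neighborSet x) (Ordinal.omega0 ^ e) y)
    {p : Finset (Ordinal.{u} × Ordinal.{u})} (hp : IsApprox G e β t p) {x η η' z : Ordinal.{u}}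
    (hx : (x, η) ∈ p) (hη : η' < η) (hz : z < x) :
    ∃ q, p ⊆ q ∧ IsApprox G e β t q ∧ ∃ v, (v, η') ∈ q ∧ z < v ∧ v < x := by
  classical
  obtain ⟨hxt, hηβ, hlim⟩ := hp.1 _ hx
  obtain ⟨v, hv, hzv, hvx, hvlim⟩ := IterLim.exists_notMem
    (not_iterLim_finset_union (fun u : Ordinal.{u} × Ordinal.{u} => G.neighborSet u.1)
      (fun u => hG u.1 x) p) hlim hη hz
  have hadj : ∀ u ∈ p, ¬ G.Adj u.1 v := fun u hu h => hv (Set.mem_biUnion hu h)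
  refine ⟨insert (v, η') p, Finset.subset_insert _ _, ⟨?_, ?_⟩, v, Finset.mem_insert_self _ _,
    hzv, hvx⟩
  · intro u hu
    rcases Finset.mem_insert.1 hu with rfl | hu
    · exact ⟨hvx.le.trans hxt, hη.le.trans hηβ, hvlim⟩
    · exact hp.1 u hu
  · intro u hu w hw
    rcases Finset.mem_insert.1 hu with rfl | hu <;> rcases Finset.mem_insert.1 hw with rfl | hw
    · exact G.irrefl
    · exact fun h => hadj w hw h.symm
    · exact hadj u hu
    · exact hp.2 u hu w hw

/-- If no ordinal has rank `ω ^ e` with respect to a neighbourhood in `G`, then below every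
countable ordinal `t` of rank at least `ω ^ e * β` there is an independent set with respect to which
`t` has rank at least `β`. The set consists of the points below `t` that occur in a sufficiently
generic ideal of finite approximations. -/
theorem exists_isIndepSet_iterLim (G : SimpleGraph Ordinal.{u}) {e β t : Ordinal.{u}}
    (hG : ∀ x y, ¬ IterLim (G.neighborSet x) (Ordinal.omega0 ^ e) y)
    (hβ : (Set.Iio β).Countable) (ht : (Set.Iio t).Countable)
    (hlim : IterLim Set.univ (Ordinal.omega0 ^ e * β) t) :
    ∃ X ⊆ Set.Iio t, G.IsIndepSet X ∧ IterLim X β t := by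
  let P := {p : Finset (Ordinal.{u} × Ordinal.{u}) // IsApprox G e β t p}
  have hcβ : Countable (Set.Iic β) := by
    rw [← Set.Iio_insert]
    exact (hβ.insert β).to_subtype
  have hct : Countable (Set.Iic t) := by
    rw [← Set.Iio_insert]
    exact (ht.insert t).to_subtype
  let ι := (Set.Iic t × Set.Iic β) × (Set.Iic β × Set.Iic t)
  let : Encodable ι := Encodable.ofCountable ι
  -- The requirement `((x, η), (η', z))`: if `η' < η` and `z < x`, then either a point with label
  -- `η'` lies strictly between `z` and `x`, or the pair `(x, η)` will never be used.
  let D : ι → Order.Cofinal P := fun i =>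
    { carrier := {p | i.2.1.1 < i.1.2.1 → i.2.2.1 < i.1.1.1 →
        (∃ v, (v, i.2.1.1) ∈ p.1 ∧ i.2.2.1 < v ∧ v < i.1.1.1) ∨
          ∀ q : P, p ≤ q → (i.1.1.1, i.1.2.1) ∉ q.1}
      isCofinal := by
        intro p
        by_cases hi : i.2.1.1 < i.1.2.1 ∧ i.2.2.1 < i.1.1.1
        · by_cases hq : ∃ q : P, p ≤ q ∧ (i.1.1.1, i.1.2.1) ∈ q.1
          · obtain ⟨q, hpq, hq⟩ := hq
            obtain ⟨q', hqq', hq', h⟩ := q.2.exists_extension hG hq hi.1 hi.2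
            exact ⟨⟨q', hq'⟩, fun _ _ => Or.inl h, hpq.trans hqq'⟩
          · push Not at hq
            exact ⟨p, fun _ _ => Or.inr hq, le_rfl⟩
        · exact ⟨p, fun h₁ h₂ => absurd ⟨h₁, h₂⟩ hi, le_rfl⟩ }
  let p₀ : P := ⟨{(t, β)}, by
    refine ⟨fun u hu => ?_, fun u hu v hv => ?_⟩
    · rw [Finset.mem_singleton.1 hu]
      exact ⟨le_rfl, le_rfl, hlim⟩
    · rw [Finset.mem_singleton.1 hu, Finset.mem_singleton.1 hv]
      exact G.irrefl⟩
  let I := Order.idealOfCofinals p₀ D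
  let X : Set Ordinal.{u} := {x | x < t ∧ ∃ p ∈ I, ∃ η, (x, η) ∈ p.1}
  refine ⟨X, fun x hx => hx.1, ?_, ?_⟩
  · rintro x ⟨-, p, hp, η, hx⟩ y ⟨-, q, hq, θ, hy⟩ -
    obtain ⟨s, -, hps, hqs⟩ := I.directed p hp q hq
    exact s.2.2 _ (hps hx) _ (hqs hy)
  · have key : ∀ η : Ordinal.{u}, ∀ x, ∀ p ∈ I, (x, η) ∈ p.1 → IterLim X η x := by
      intro η
      induction η using WellFoundedLT.induction with
      | ind η ih =>
      intro x p hp hx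
      obtain ⟨hxt, hηβ, hxlim⟩ := p.2.1 _ hx
      rw [iterLim_iff]
      intro η' hη'
      have hpos : 0 < Ordinal.omega0 ^ e * η :=
        mul_pos (Ordinal.opow_pos _ Ordinal.omega0_pos) (bot_le.trans_lt hη')
      refine ⟨((iterLim_iff.1 hxlim) 0 hpos).1, fun z hz => ?_⟩
      obtain ⟨q, hqD, hqI⟩ := Order.cofinal_meets_idealOfCofinals p₀ D
        ((⟨x, hxt⟩, ⟨η, hηβ⟩), (⟨η', hη'.le.trans hηβ⟩, ⟨z, hz.le.trans hxt⟩))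
      rcases hqD hη' hz with ⟨v, hv, hzv, hvx⟩ | hno
      · exact ⟨v, ⟨hvx.trans_le hxt, q, hqI, η', hv⟩, hzv, hvx, ih η' hη' v q hqI hv⟩
      · obtain ⟨s, -, hps, hqs⟩ := I.directed p hp q hqI
        exact absurd (hps hx) (hno s hqs)
    exact key β t p₀ (Order.mem_idealOfCofinals p₀ D) (Finset.mem_singleton_self _)

/-! ### The partition relation for graphs -/

theorem countable_Iio_iff_card_le_aleph0 {o : Ordinal.{u}} :
    (Set.Iio o).Countable ↔ o.card ≤ Cardinal.aleph0 := by
  rw [← Cardinal.le_aleph0_iff_set_countable, Cardinal.mk_Iio_ordinal, Cardinal.lift_le_aleph0]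

theorem nat_card_Iio_natCast (k : ℕ) : Nat.card (Set.Iio (k : Ordinal.{u})) = k := by
  rw [Nat.card, Cardinal.mk_Iio_ordinal]
  simp

theorem finite_Iio_natCast (k : ℕ) : Finite (Set.Iio (k : Ordinal.{u})) := by
  rw [Set.finite_coe_iff, ← Cardinal.lt_aleph0_iff_set_finite, Cardinal.mk_Iio_ordinal]
  simp

/-- For pairs and two colors, with the second target finite, the topological partition relation
says that every graph on `δ` has an independent copy of `κ` or a clique of size `k`. -/
theorem topArrow_pair_iff {δ κ : Ordinal.{u}} {k : ℕ} :
    TopArrow δ ![κ, (k : Ordinal.{u})] 2 ↔ ∀ G : SimpleGraph (Set.Iio δ),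
      (∃ X : Set (Set.Iio δ), G.IsIndepSet X ∧ Nonempty (X ≃ₜ Set.Iio κ)) ∨
        ∃ S : Finset (Set.Iio δ), G.IsNClique k S := by
  classical
  constructor
  · intro h G
    obtain ⟨X, i, hX, ⟨f⟩⟩ :=
      h fun s => if G.IsClique ((s : Finset (Set.Iio δ)) : Set (Set.Iio δ)) then 1 else 0
    have hpair : ∀ x ∈ X, ∀ y ∈ X, x ≠ y →
        (if G.IsClique (({x, y} : Finset (Set.Iio δ)) : Set (Set.Iio δ)) then (1 : Fin 2) else 0)
          = i := by
      intro x hx y hy hxy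
      refine hX ⟨{x, y}, Finset.card_pair hxy⟩ ?_
      intro v hv
      rcases Finset.mem_insert.1 (Finset.mem_coe.1 hv) with rfl | hv
      · exact hx
      · rwa [Finset.mem_singleton.1 hv]
    simp only [Finset.coe_pair, SimpleGraph.isClique_pair] at hpair
    match i with
    | 0 =>
      refine Or.inl ⟨X, fun x hx y hy hxy hadj => ?_, ⟨f⟩⟩
      have h := hpair x hx y hy hxy
      rw [if_pos fun _ => hadj] at h
      exact one_ne_zero h
    | 1 =>
      have hcard : Nat.card X = k := (Nat.card_congr f.toEquiv).trans (nat_card_Iio_natCast k)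
      have := finite_Iio_natCast.{u} k
      have hXfin : X.Finite :=
        Set.finite_coe_iff.1 (Finite.of_equiv (Set.Iio (k : Ordinal.{u})) f.toEquiv.symm)
      refine Or.inr ⟨hXfin.toFinset, ⟨?_, ?_⟩⟩
      · rw [hXfin.coe_toFinset]
        intro x hx y hy hxy
        by_contra hadj
        have h := hpair x hx y hy hxy
        rw [if_neg fun h => hadj (h hxy)] at h
        exact zero_ne_one h
      · rw [← Set.ncard_eq_toFinset_card X hXfin, ← Nat.card_coe_set_eq, hcard]
  · intro h c
    let G : SimpleGraph (Set.Iio δ) :=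
      { Adj := fun x y => ∃ s : Set.powersetCard (Set.Iio δ) 2,
          x ≠ y ∧ (s : Finset (Set.Iio δ)) = {x, y} ∧ c s = 1
        symm := ⟨fun x y ⟨s, hne, hs, hc⟩ => ⟨s, hne.symm, by rw [hs, Finset.pair_comm], hc⟩⟩
        loopless := ⟨fun x ⟨_, hne, _⟩ => hne rfl⟩ }
    have hmem : ∀ (s : Set.powersetCard (Set.Iio δ) 2), ∃ x y, x ≠ y ∧
        (s : Finset (Set.Iio δ)) = {x, y} := fun s => Finset.card_eq_two.1 s.2
    rcases h G with ⟨X, hX, hf⟩ | ⟨S, hS⟩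
    · refine ⟨X, 0, fun s hs => ?_, hf⟩
      obtain ⟨x, y, hxy, hsxy⟩ := hmem s
      rw [hsxy, Finset.coe_pair, Set.pair_subset_iff] at hs
      by_contra hc
      exact hX hs.1 hs.2 hxy ⟨s, hxy, hsxy, Fin.eq_one_of_ne_zero _ hc⟩
    · refine ⟨S, 1, fun s hs => ?_, ?_⟩
      · obtain ⟨x, y, hxy, hsxy⟩ := hmem s
        rw [hsxy, Finset.coe_pair, Set.pair_subset_iff] at hs
        obtain ⟨s', -, hs', hc⟩ := hS.isClique hs.1 hs.2 hxy
        rwa [Subtype.ext (hsxy.trans hs'.symm : (s : Finset (Set.Iio δ)) = s')]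
      · have := finite_Iio_natCast.{u} k
        have hcard : Nat.card (S : Set (Set.Iio δ)) = Nat.card (Set.Iio (k : Ordinal.{u})) := by
          rw [nat_card_Iio_natCast, ← hS.card_eq]
          simp
        obtain ⟨f⟩ := Finite.card_eq.1 hcard
        exact ⟨f.toHomeomorphOfDiscrete⟩

/-! ### The weak topological Erdős–Milner theorem -/

theorem mainTheorem1 (α β : Ordinal) (hα : α.card ≤ Cardinal.aleph0) (hβ : β.card ≤ Cardinal.aleph0)
    (hα0 : α ≠ 0) (hβ0 : β ≠ 0) (k : ℕ) (hk : 1 < k)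
    (h : TopArrow (Ordinal.omega0 ^ (Ordinal.omega0 ^ α))
      ![Ordinal.omega0 ^ β, (k : Ordinal)] 2) :
    TopArrow (Ordinal.omega0 ^ (Ordinal.omega0 ^ α * β))
      ![Ordinal.omega0 ^ β, ((k + 1 : ℕ) : Ordinal)] 2 := by
  classical
  have hopow : ∀ {o : Ordinal}, o.card ≤ Cardinal.aleph0 →
      (Ordinal.omega0 ^ o).card ≤ Cardinal.aleph0 := fun {o} ho =>
    (Ordinal.card_opow_le _ _).trans (by simp [ho])
  have hγ := hopow hα
  have ht : (Set.Iio (Ordinal.omega0 ^ (Ordinal.omega0 ^ α * β))).Countable := by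
    refine countable_Iio_iff_card_le_aleph0.2 (hopow ?_)
    rw [Ordinal.card_mul]
    exact (mul_le_mul' hγ hβ).trans Cardinal.aleph0_mul_aleph0.le
  have hγpos : 0 < Ordinal.omega0 ^ α := Ordinal.opow_pos _ Ordinal.omega0_pos
  have hlim : IterLim Set.univ (Ordinal.omega0 ^ α * β)
      (Ordinal.omega0 ^ (Ordinal.omega0 ^ α * β)) := by
    simpa using iterLim_univ_add_omega0_opow (Ordinal.omega0 ^ α * β) 0
  rw [topArrow_pair_iff] at h ⊢
  generalize Ordinal.omega0 ^ (Ordinal.omega0 ^ α * β) = t at ht hlim ⊢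
  intro G
  let G' : SimpleGraph Ordinal := G.map (Function.Embedding.subtype _)
  have hsub : ∀ x, G'.neighborSet x ⊆ Set.Iio t := by
    intro x y hy
    obtain ⟨a, b, -, -, rfl⟩ := (SimpleGraph.map_adj _ _ _ _).1 hy
    exact b.2
  have hadj : ∀ x y : Set.Iio t, G'.Adj x.1 y.1 ↔ G.Adj x y := fun x y =>
    SimpleGraph.map_adj_apply (f := Function.Embedding.subtype _) (a := x) (b := y)
  by_cases H : ∀ x y, ¬ IterLim (G'.neighborSet x) (Ordinal.omega0 ^ α) y
  · -- All neighbourhoods are small: the generic construction gives the independent set.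
    have hβc := countable_Iio_iff_card_le_aleph0.2 hβ
    obtain ⟨X, hXt, hXind, hX⟩ := exists_isIndepSet_iterLim G' H hβc ht hlim
    obtain ⟨g, hg, hgX⟩ := hX.exists_isEmbedding hβ0 hβc ht
    let g' : Set.Iio (Ordinal.omega0 ^ β) → Set.Iio t := fun x => ⟨g x, (hgX x).2⟩
    have hg' : Topology.IsEmbedding g' := hg.codRestrict _ _
    refine Or.inl ⟨Set.range g', ?_, ⟨hg'.toHomeomorph.symm⟩⟩
    rintro _ ⟨x, rfl⟩ _ ⟨y, rfl⟩ hxy hG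
    exact hXind (hgX x).1 (hgX y).1 (fun h => hxy (Subtype.ext h))
      ((hadj (g' x) (g' y)).2 hG)
  · -- Some neighbourhood contains a copy of `ω ^ ω ^ α`, to which the hypothesis applies.
    push Not at H
    obtain ⟨x, y, hy⟩ := H
    have hyc := ht.mono (Set.Iio_subset_Iio (hy.le_of_subset_Iio (hsub x) hγpos))
    obtain ⟨g, hg, hgX⟩ :=
      hy.exists_isEmbedding hγpos.ne' (countable_Iio_iff_card_le_aleph0.2 hγ) hyc
    have hx0 : G'.Adj x (g ⟨0, Ordinal.opow_pos _ Ordinal.omega0_pos⟩) := (hgX _).1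
    have hx : x < t := hsub _ hx0.symm
    let g' : Set.Iio (Ordinal.omega0 ^ (Ordinal.omega0 ^ α)) → Set.Iio t :=
      fun v => ⟨g v, hsub x (hgX v).1⟩
    have hg' : Topology.IsEmbedding g' := hg.codRestrict _ _
    have hxg : ∀ v, G.Adj ⟨x, hx⟩ (g' v) := fun v => (hadj ⟨x, hx⟩ (g' v)).1 (hgX v).1
    rcases h (G.comap g') with ⟨X, hX, ⟨f⟩⟩ | ⟨S, hS⟩
    · refine Or.inl ⟨g' '' X, ?_, ⟨(hg'.homeomorphImage X).symm.trans f⟩⟩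
      rintro _ ⟨v, hv, rfl⟩ _ ⟨w, hw, rfl⟩ hvw
      exact hX hv hw (fun h => hvw (congrArg g' h))
    · refine Or.inr ⟨insert ⟨x, hx⟩ (S.map ⟨g', hg'.injective⟩), ?_⟩
      refine SimpleGraph.IsNClique.insert ⟨?_, ?_⟩ ?_
      · rw [Finset.coe_map]
        rintro _ ⟨v, hv, rfl⟩ _ ⟨w, hw, rfl⟩ hvw
        exact hS.isClique hv hw (fun h => hvw (congrArg g' h))
      · rw [Finset.card_map, hS.card_eq]
      · intro b hb
        obtain ⟨v, -, rfl⟩ := Finset.mem_map.1 hb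
        exact hxg v
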